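/- **Setting.** There are finitely many advertisers $i\in N$, a finite universe $S$ of ads, a total space $W\ge 0$, and for every pair $(i,j)\in N\times S$ a space $w_{ij}$ with $0<w_{ij}\le W$ and a click probability $\alpha_{ij}\in[0,1]$. Advertiser $i$ reports a bid $b_i\ge 0$ and a set of ads $S_i\subseteq S$; put $b_{ij}=b_i\alpha_{ij}$ if $j\in S_i$ and $b_{ij}=0$ otherwise. A feasible (fractional) allocation is $x\in[0,1]^{N\times S}$ with $x_{ij}=0$ for $j\notin S_i$, $\sum_j x_{ij}\le 1$ for every $i$, and $\sum_{i,j}w_{ij}x_{ij}\le W$; it is integral if all $x_{ij}\in\{0,1\}$. Its social welfare is $SW(x)=\sum_{i,j}x_{ij}b_{ij}$, and advertiser $i$ gets $x_i=\sum_{j\in S_i}x_{ij}\alpha_{ij}$ expected clicks. Let $OPT$ be the maximum of $SW$ over feasible fractional allocations, and $b_{\max}=\max_{i,\,j\in S_i}b_{ij}$ ($0$ if no ad is reported). Ties between pairs $(i,j)$ are broken by an arbitrary fixed strict order on $N\times S$ that does not depend on the reports, except that ties in value between ads of one advertiser are first broken in favour of larger $\alpha_{ij}$ when the ad she receives is chosen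 (this matters only if $b_i=0$). **Rules.** $ALG_B$ starts with remaining space $w=W$, with all reported ads available, and with nothing allocated. While $w\neq0$ and some ad is available, take an available pair $(i,j)$ with the largest bang-per-buck $b_{ij}/w_{ij}$; make all ads of $i$ of space at most $w_{ij}$ (including $j$) unavailable; let $w_0$ be the space currently allotted to $i$. If $w_{ij}-w_0\le w$, replace the current ad of $i$ by $j$ (so $x_{ij}=1$) and decrease $w$ by $w_{ij}-w_0$. Otherwise replace it by the fraction $x_{ij}=(w_0+w)/w_{ij}$ of $j$ and set $w=0$. Let $W_i=\sum_j w_{ij}x_{ij}$ be the final space of $i$. $ALG_I$ gives each advertiser $i$ one ad $j\in S_i$ with $w_{ij}\le W_i$ of maximum $b_{ij}$ (none if no ad fits). $ALG_{\max}$ allocates a single ad, one of value $b_{\max}$ (none if no ad is reported). **Theorem.** For all bids and ad sets, $ALG_I$ and $ALG_{\max}$ output feasible integral allocations, and $SW(ALG_{\max})=b_{\max}$. Consider the randomized rule that runs $ALG_I$ with probability $2/3$ and $ALG_{\max}$ with probability $1/3$; its allocation probabilities are $x=\tfrac23x(ALG_I)+\tfrac13x(ALG_{\max})$. 1. It is monotone: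 for every $i$, with the other reports fixed, $x_i$ does not decrease if $b_i$ is replaced by $b_i'\ge b_i$, nor if $S_i$ is replaced by $S_i'\supseteq S_i$. 2. $2\,SW(ALG_I)+b_{\max}\ge OPT$, and the rule is a $3$-approximation to the optimal fractional social welfare: $3\,SW(x)\ge OPT$. 3. The factor $3$ is tight: for every $c<3$ there is an instance with all $b_i>0$ and pairwise disjoint sets $S_i$ on which $c\cdot SW(x)<OPT$, for every choice of the tie-breaking order. -/

import Mathlib

noncomputable section

namespace RichAds

/-- The public data of a rich-ad auction with advertisers `N` and universe of rich ads `S`: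
the total space `W`, the space `w i j` and the click probability `α i j` of ad `j` for
advertiser `i`. -/
structure Setting (N S : Type*) where
  W : ℝ
  w : N → S → ℝ
  α : N → S → ℝ
  W_nonneg : 0 ≤ W
  w_pos : ∀ i j, 0 < w i j
  w_le : ∀ i j, w i j ≤ W
  α_nonneg : ∀ i j, 0 ≤ α i j
  α_le_one : ∀ i j, α i j ≤ 1

/-- A (randomized or fractional) allocation: `x i j` is the probability (or fraction) with which
ad `j` is allocated to advertiser `i`. -/
abbrev Allocation (N S : Type*) := N → S → ℝ

/-- An allocation rule maps the reported bids and ad sets to an allocation. -/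
abbrev AllocationRule (N S : Type*) := (N → ℝ) → (N → Finset S) → Allocation N S

/-- An element of the nonempty finite set `s` that maximizes `key`. -/
def argBest {ι κ : Type*} [LinearOrder κ] (key : ι → κ) (s : Finset ι) (h : s.Nonempty) : ι :=
  (s.exists_max_image key h).choose

theorem argBest_mem {ι κ : Type*} [LinearOrder κ] (key : ι → κ) (s : Finset ι)
    (h : s.Nonempty) : argBest key s h ∈ s :=
  (s.exists_max_image key h).choose_spec.1

theorem le_argBest {ι κ : Type*} [LinearOrder κ] (key : ι → κ) (s : Finset ι)
    (h : s.Nonempty) {a : ι} (ha : a ∈ s) : key a ≤ key (argBest key s h) :=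
  (s.exists_max_image key h).choose_spec.2 a ha

section
variable {N S : Type*} [Fintype N] [Fintype S] [DecidableEq N] [DecidableEq S]

/-- The reported value `b i j` of ad `j` for advertiser `i`: it is `b i * α i j` if `j` belongs
to the reported set of `i`, and `0` otherwise. -/
def value (G : Setting N S) (b : N → ℝ) (R : N → Finset S) (i : N) (j : S) : ℝ :=
  if j ∈ R i then b i * G.α i j else 0

/-- The space occupied by advertiser `i` under the allocation `x`. -/
def space (G : Setting N S) (x : Allocation N S) (i : N) : ℝ :=
  ∑ j, G.w i j * x i j

/-- The expected number of clicks of advertiser `i` under the allocation `x`. -/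
def clicks (G : Setting N S) (R : N → Finset S) (x : Allocation N S) (i : N) : ℝ :=
  ∑ j ∈ R i, x i j * G.α i j

/-- Social welfare with respect to the reports. -/
def socialWelfare (G : Setting N S) (b : N → ℝ) (R : N → Finset S) (x : Allocation N S) : ℝ :=
  ∑ i, ∑ j, x i j * value G b R i j

/-- Feasible (fractional) allocations for the reported ad sets `R`. -/
structure IsFeasible (G : Setting N S) (R : N → Finset S) (x : Allocation N S) : Prop where
  nonneg : ∀ i j, 0 ≤ x i j
  le_one : ∀ i j, x i j ≤ 1
  valid : ∀ i j, j ∉ R i → x i j = 0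
  unit_demand : ∀ i, ∑ j, x i j ≤ 1
  total_space : ∑ i, space G x i ≤ G.W

/-- Every entry is `0` or `1`. -/
def IsIntegral (x : Allocation N S) : Prop := ∀ i j, x i j = 0 ∨ x i j = 1

/-- The optimal fractional social welfare. -/
def optSW (G : Setting N S) (b : N → ℝ) (R : N → Finset S) : ℝ :=
  sSup (socialWelfare G b R '' {x | IsFeasible G R x})

/-- The value of the maximum-value ad (`0` if no ad is reported; values are nonnegative for
nonnegative bids, and ads that are not reported have value `0`). -/
def bMax (G : Setting N S) (b : N → ℝ) (R : N → Finset S) : ℝ :=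
  ⨆ p : N × S, value G b R p.1 p.2

/-! ### The space allocation by absolute bang-per-buck -/

/-- The order in which advertiser-ad pairs are considered: larger bang-per-buck first, ties broken
by the smaller `rank`. -/
def bpbKey (G : Setting N S) (rank : N × S → ℕ) (b : N → ℝ) (R : N → Finset S) (p : N × S) :
    ℝ ×ₗ ℕᵒᵈ :=
  toLex (value G b R p.1 p.2 / G.w p.1 p.2, OrderDual.toDual (rank p))

/-- State of the bang-per-buck algorithm: remaining space, available advertiser-ad pairs, and the
current allocation. -/
structure BState (N S : Type*) where
  rem : ℝ
  avail : Finset (N × S)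
  alloc : Allocation N S

/-- The initial state: all the space remains, all reported ads are available, nothing is
allocated. -/
def initB (G : Setting N S) (R : N → Finset S) : BState N S where
  rem := G.W
  avail := Finset.univ.filter (fun p => p.2 ∈ R p.1)
  alloc := fun _ _ => 0

/-- One round of the bang-per-buck algorithm, once the best available pair `p = (i, j)` is known.
All ads of `i` of space at most `w i j` (including `j`) become unavailable. The ad `j` replaces the
ad previously allocated to `i`, which occupies `space G s.alloc i` (`0` if there is none): fully if
the additional space is available, and otherwise fractionally, using up all remaining space. -/
def roundB (G : Setting N S) (s : BState N S) (p : N × S) : BState N S where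
  rem :=
    if G.w p.1 p.2 - space G s.alloc p.1 ≤ s.rem then
      s.rem - G.w p.1 p.2 + space G s.alloc p.1
    else 0
  avail := s.avail.filter (fun q => ¬ (q.1 = p.1 ∧ G.w q.1 q.2 ≤ G.w p.1 p.2))
  alloc :=
    if G.w p.1 p.2 - space G s.alloc p.1 ≤ s.rem then
      Function.update s.alloc p.1 (Pi.single p.2 1)
    else
      Function.update s.alloc p.1
        (Pi.single p.2 ((space G s.alloc p.1 + s.rem) / G.w p.1 p.2))

/-- The body of the while loop: nothing happens once no space or no available ad is left. -/
def stepB (G : Setting N S) (rank : N × S → ℕ) (b : N → ℝ) (R : N → Finset S)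
    (s : BState N S) : BState N S :=
  open Classical in
  if h : s.rem ≠ 0 ∧ s.avail.Nonempty then
    roundB G s (argBest (bpbKey G rank b R) s.avail h.2)
  else s

/-- The state in which the while loop stops. Each round makes at least one ad unavailable, so
`|N × S|` rounds suffice, see `finalB_halted`. -/
def finalB (G : Setting N S) (rank : N × S → ℕ) (b : N → ℝ) (R : N → Finset S) : BState N S :=
  (stepB G rank b R)^[Fintype.card (N × S)] (initB G R)

/-- The allocation rule `ALG_B`. -/
def algB (G : Setting N S) (rank : N × S → ℕ) : AllocationRule N S :=
  fun b R => (finalB G rank b R).alloc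

theorem stepB_card (G : Setting N S) (rank : N × S → ℕ) (b : N → ℝ) (R : N → Finset S)
    (s : BState N S) :
    ((stepB G rank b R s).rem = 0 ∨ (stepB G rank b R s).avail = ∅) ∨
      (stepB G rank b R s).avail.card < s.avail.card := by
  unfold stepB
  split_ifs with h
  · right
    apply Finset.card_lt_card
    refine (Finset.filter_ssubset).2 ⟨_, argBest_mem (bpbKey G rank b R) s.avail h.2, ?_⟩
    simp
  · left
    by_contra hc
    rw [not_or] at hc
    exact h ⟨hc.1, Finset.nonempty_iff_ne_empty.2 hc.2⟩

theorem stepB_halted (G : Setting N S) (rank : N × S → ℕ) (b : N → ℝ) (R : N → Finset S)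
    (s : BState N S) (h : s.rem = 0 ∨ s.avail = ∅) : stepB G rank b R s = s := by
  unfold stepB
  rw [dif_neg]
  rintro ⟨h1, h2⟩
  rcases h with h | h
  · exact h1 h
  · exact h2.ne_empty h

theorem finalB_halted (G : Setting N S) (rank : N × S → ℕ) (b : N → ℝ) (R : N → Finset S) :
    (finalB G rank b R).rem = 0 ∨ (finalB G rank b R).avail = ∅ := by
  have key : ∀ (n : ℕ) (s : BState N S), s.avail.card ≤ n →
      ((stepB G rank b R)^[n] s).rem = 0 ∨ ((stepB G rank b R)^[n] s).avail = ∅ := by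
    intro n
    induction n with
    | zero =>
      intro s hs
      right
      simpa using hs
    | succ n ih =>
      intro s hs
      rw [Function.iterate_succ_apply]
      rcases stepB_card G rank b R s with h | h
      · rw [Function.iterate_fixed (stepB_halted G rank b R _ h)]
        exact h
      · exact ih _ (by omega)
  exact key _ _ (Finset.card_le_univ _)

/-! ### The integral rules and their mixture -/

/-- The preference of advertiser `i` among her own ads: larger value first, ties in favour of
more clicks (which matters only for bid `0`), remaining ties by the smaller `rank`. -/
def adKey (G : Setting N S) (rank : N × S → ℕ) (b : N → ℝ) (R : N → Finset S) (i : N) (j : S) :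
    ℝ ×ₗ (ℝ ×ₗ ℕᵒᵈ) :=
  toLex (value G b R i j, toLex (G.α i j, OrderDual.toDual (rank (i, j))))

/-- The integral allocation row of advertiser `i` that selects the best ad in `F` for her
(nothing if `F` is empty). -/
def bestRow (G : Setting N S) (rank : N × S → ℕ) (b : N → ℝ) (R : N → Finset S) (i : N)
    (F : Finset S) : S → ℝ :=
  open Classical in
  if h : F.Nonempty then Pi.single (argBest (adKey G rank b R i) F h) 1 else 0

/-- The allocation rule `ALG_I`: each advertiser gets the maximum-value single ad that fits in
the space which `ALG_B` allots to her. -/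
def algI (G : Setting N S) (rank : N × S → ℕ) : AllocationRule N S :=
  fun b R i =>
    bestRow G rank b R i ((R i).filter (fun j => G.w i j ≤ space G (algB G rank b R) i))

/-- The order of the pairs by value, ties broken by the smaller `rank`. -/
def valueKey (G : Setting N S) (rank : N × S → ℕ) (b : N → ℝ) (R : N → Finset S) (p : N × S) :
    ℝ ×ₗ ℕᵒᵈ :=
  toLex (value G b R p.1 p.2, OrderDual.toDual (rank p))

/-- The rule that allocates only a maximum-value ad: the advertiser who owns the first pair in the
order by value wins, and gets the best of her reported ads. -/
def algMax (G : Setting N S) (rank : N × S → ℕ) : AllocationRule N S :=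
  fun b R i =>
    open Classical in
    if h : (Finset.univ.filter (fun p : N × S => p.2 ∈ R p.1)).Nonempty then
      if i = (argBest (valueKey G rank b R) _ h).1 then bestRow G rank b R i (R i) else 0
    else 0

/-- The randomized rule that runs `ALG_I` with probability `2/3` and otherwise allocates the
maximum-value ad, given by its allocation probabilities. -/
def mixedRule (G : Setting N S) (rank : N × S → ℕ) : AllocationRule N S :=
  fun b R i j => 2 / 3 * algI G rank b R i j + 1 / 3 * algMax G rank b R i j

/-- Monotonicity of an allocation rule in each bid `b i` and each reported ad set `R i`: the
expected number of clicks of `i` does not decrease when she raises her bid or reports more ads. -/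
def IsMonotoneRule (G : Setting N S) (f : AllocationRule N S) : Prop :=
  (∀ (b : N → ℝ) (R : N → Finset S) (i : N) (b' : ℝ), (∀ k, 0 ≤ b k) → b i ≤ b' →
    clicks G R (f b R) i ≤ clicks G R (f (Function.update b i b') R) i) ∧
  (∀ (b : N → ℝ) (R : N → Finset S) (i : N) (R' : Finset S), (∀ k, 0 ≤ b k) → R i ⊆ R' →
    clicks G R (f b R) i ≤
      clicks G (Function.update R i R') (f b (Function.update R i R')) i)

end

end RichAds

end

/-!
The space `W_i` that the bang-per-buck algorithm allots to advertiser `i` has a closed form: it is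
the maximum over her reported ads `j` of the minimum of `w i j` and the space left by what the other
advertisers demand for their ads that precede `(i, j)` in the order by bang-per-buck
(`IsGreedySpace.lower` and `IsGreedySpace.upper`). A higher bid moves the ads of `i` forward in this
order, and more ads enlarge the set over which the maximum is taken, so `W_i` does not decrease
(`IsGreedySpace.le_of_improves`). The clicks of `i` under `algI` are the largest click probability
among her ads of size at most `W_i`, hence monotone as well. Under `algMax` an advertiser
who wins keeps winning after an improvement of her report.

For the approximation, let `β` be the largest bang-per-buck of an ad that does not fit into the
allotted space of its owner. A feasible allocation gets from the fitting ads at most the welfare of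
`algI`, and from the others at most `β * W` (`IsFeasible.socialWelfare_le`). If there are such ads,
then the whole space is allotted, to ads of bang-per-buck at least `β`; so `β * W_i` is at most the
value `algI` gives to `i`, except for the one advertiser with a fractional ad, for whom it is at
most `bMax` (`exists_price`). Together the optimum is at most twice the welfare of `algI` plus
`bMax`, which is three times the welfare of the mixture.

Both halves of this bound can be attained almost exactly at once, see `tightSetting`: one
advertiser exchanges a tiny ad for a large one of the same value, and almost all of the remaining
space goes to a fraction of another advertiser's ad, which `algI` cannot use.

All facts about the run of the algorithm are collected in `IsGreedySpace`, which holds for the final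
spaces by `exists_isGreedySpace`.
-/

namespace RichAds

set_option linter.unusedSectionVars false

section
variable {N S : Type*} [Fintype N] [Fintype S] [DecidableEq N] [DecidableEq S]

/-! ### Keys and values -/

theorem value_nonneg (G : Setting N S) {b : N → ℝ} (R : N → Finset S) {i : N} (hb : 0 ≤ b i)
    (j : S) : 0 ≤ value G b R i j := by
  unfold value
  split_ifs
  · exact mul_nonneg hb (G.α_nonneg i j)
  · exact le_rfl

theorem bpbKey_injective (G : Setting N S) {rank : N × S → ℕ} (hr : Function.Injective rank)
    (b : N → ℝ) (R : N → Finset S) : Function.Injective (bpbKey G rank b R) := by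
  intro p q h
  have h' := congrArg (fun z => OrderDual.ofDual (ofLex z).2) h
  exact hr h'

theorem ratio_le_of_bpbKey_le {G : Setting N S} {rank : N × S → ℕ} {b : N → ℝ}
    {R : N → Finset S} {p q : N × S} (h : bpbKey G rank b R p ≤ bpbKey G rank b R q) :
    value G b R p.1 p.2 / G.w p.1 p.2 ≤ value G b R q.1 q.2 / G.w q.1 q.2 := by
  unfold bpbKey at h
  rw [Prod.Lex.toLex_le_toLex] at h
  rcases h with h | h
  · exact h.le
  · exact h.1.le

theorem value_le_of_valueKey_le {G : Setting N S} {rank : N × S → ℕ} {b : N → ℝ}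
    {R : N → Finset S} {p q : N × S} (h : valueKey G rank b R p ≤ valueKey G rank b R q) :
    value G b R p.1 p.2 ≤ value G b R q.1 q.2 := by
  unfold valueKey at h
  rw [Prod.Lex.toLex_le_toLex] at h
  rcases h with h | h
  · exact h.le
  · exact h.1.le

theorem value_le_of_adKey_le {G : Setting N S} {rank : N × S → ℕ} {b : N → ℝ}
    {R : N → Finset S} {i : N} {j k : S} (h : adKey G rank b R i j ≤ adKey G rank b R i k) :
    value G b R i j ≤ value G b R i k := by
  unfold adKey at h
  rw [Prod.Lex.toLex_le_toLex] at h
  rcases h with h | h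
  · exact h.le
  · exact h.1.le

/-- Among her reported ads, an advertiser prefers more clicks, whatever her bid: for a positive bid
values are proportional to clicks, and for bid `0` the second component of the key decides. -/
theorem α_le_of_adKey_le {G : Setting N S} {rank : N × S → ℕ} {b : N → ℝ}
    {R : N → Finset S} {i : N} {j k : S} (hb : 0 ≤ b i) (hj : j ∈ R i) (hk : k ∈ R i)
    (h : adKey G rank b R i j ≤ adKey G rank b R i k) : G.α i j ≤ G.α i k := by
  unfold adKey at h
  rw [Prod.Lex.toLex_le_toLex] at h
  rcases h with h | ⟨-, h⟩
  · simp only [value, hj, hk, if_true] at h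
    exact (lt_of_mul_lt_mul_left h hb).le
  · simp only [Prod.Lex.toLex_le_toLex] at h
    rcases h with h | h
    · exact h.le
    · exact h.1.le

/-! ### The row of a best ad -/

theorem bestRow_sum_of_nonempty (G : Setting N S) (rank : N × S → ℕ) (b : N → ℝ)
    (R : N → Finset S) (i : N) {F T : Finset S} (h : F.Nonempty) (hFT : F ⊆ T) (f : S → ℝ) :
    ∑ j ∈ T, bestRow G rank b R i F j * f j = f (argBest (adKey G rank b R i) F h) := by
  rw [Finset.sum_eq_single_of_mem _ (hFT (argBest_mem (adKey G rank b R i) F h))]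
  · simp [bestRow, h]
  · intro j _ hj
    simp [bestRow, h, hj]

theorem bestRow_empty (G : Setting N S) (rank : N × S → ℕ) (b : N → ℝ)
    (R : N → Finset S) (i : N) : bestRow G rank b R i ∅ = 0 := by
  simp [bestRow]

theorem bestRow_eq_zero_or_one (G : Setting N S) (rank : N × S → ℕ) (b : N → ℝ)
    (R : N → Finset S) (i : N) (F : Finset S) (j : S) :
    bestRow G rank b R i F j = 0 ∨ bestRow G rank b R i F j = 1 := by
  unfold bestRow
  split_ifs with h
  · by_cases hj : j = argBest (adKey G rank b R i) F h
    · right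
      rw [hj, Pi.single_eq_same]
    · left
      rw [Pi.single_eq_of_ne hj]
  · left
    rfl

theorem bestRow_eq_zero_of_notMem (G : Setting N S) (rank : N × S → ℕ) (b : N → ℝ)
    (R : N → Finset S) (i : N) {F : Finset S} {j : S} (hj : j ∉ F) :
    bestRow G rank b R i F j = 0 := by
  unfold bestRow
  split_ifs with h
  · rw [Pi.single_eq_of_ne]
    rintro rfl
    exact hj (argBest_mem _ _ _)
  · rfl

theorem bestRow_sum_le (G : Setting N S) (rank : N × S → ℕ) (b : N → ℝ)
    (R : N → Finset S) (i : N) {F : Finset S} {f : S → ℝ} {c : ℝ} (hc : 0 ≤ c)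
    (hf : ∀ j ∈ F, f j ≤ c) : ∑ j, bestRow G rank b R i F j * f j ≤ c := by
  rcases F.eq_empty_or_nonempty with rfl | h
  · simpa [bestRow_empty] using hc
  · rw [bestRow_sum_of_nonempty G rank b R i h (Finset.subset_univ _)]
    exact hf _ (argBest_mem _ _ _)

theorem value_le_bestRow_sum (G : Setting N S) (rank : N × S → ℕ) (b : N → ℝ)
    (R : N → Finset S) (i : N) {F : Finset S} {j : S} (hj : j ∈ F) :
    value G b R i j ≤ ∑ k, bestRow G rank b R i F k * value G b R i k := by
  rw [bestRow_sum_of_nonempty G rank b R i ⟨j, hj⟩ (Finset.subset_univ _)]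
  exact value_le_of_adKey_le (le_argBest (adKey G rank b R i) F ⟨j, hj⟩ hj)

theorem bestRow_sum_nonneg (G : Setting N S) (rank : N × S → ℕ) (b : N → ℝ)
    (R : N → Finset S) (i : N) (F T : Finset S) {f : S → ℝ} (hf : ∀ j, 0 ≤ f j) :
    0 ≤ ∑ j ∈ T, bestRow G rank b R i F j * f j := by
  refine Finset.sum_nonneg fun j _ => mul_nonneg ?_ (hf j)
  rcases bestRow_eq_zero_or_one G rank b R i F j with h | h <;> simp [h]

/-- The clicks from the best ad of a set do not decrease when the set grows, even if the reports
that define the preference order change as well. -/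
theorem bestRow_clicks_mono (G : Setting N S) (rank : N × S → ℕ) {b b' : N → ℝ}
    {R R' : N → Finset S} {i : N} {F F' : Finset S} (hb' : 0 ≤ b' i)
    (hF : F ⊆ R i) (hF' : F' ⊆ R' i) (hFF' : F ⊆ F') :
    ∑ j ∈ R i, bestRow G rank b R i F j * G.α i j ≤
      ∑ j ∈ R' i, bestRow G rank b' R' i F' j * G.α i j := by
  rcases F.eq_empty_or_nonempty with rfl | h
  · simpa [bestRow_empty] using
      bestRow_sum_nonneg G rank b' R' i F' (R' i) (G.α_nonneg i)
  · have hm := hFF' (argBest_mem (adKey G rank b R i) F h)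
    rw [bestRow_sum_of_nonempty G rank b R i h hF,
      bestRow_sum_of_nonempty G rank b' R' i (h.mono hFF') hF']
    exact α_le_of_adKey_le hb' (hF' hm) (hF' (argBest_mem _ _ _)) (le_argBest _ _ _ hm)

/-! ### The spaces allotted by the bang-per-buck algorithm -/

/-- What the analysis needs to know about the spaces `U k` allotted by the bang-per-buck algorithm;
`E` contains the advertiser whose ad is fractional, if there is one. Either the whole space is
allotted, or every reported ad fits into the space of its owner. The last field says that the
space of an advertiser comes from an ad of hers that is considered no later than any reported ad
larger than the final space of its owner. -/
structure IsGreedySpace (G : Setting N S) (rank : N × S → ℕ) (b : N → ℝ) (R : N → Finset S)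
    (U : N → ℝ) (E : Finset N) : Prop where
  nonneg : ∀ k, 0 ≤ U k
  sum_le : ∑ k, U k ≤ G.W
  full : ∑ k, U k = G.W ∨ ∀ q : N × S, q.2 ∈ R q.1 → G.w q.1 q.2 ≤ U q.1
  card_le : E.card ≤ 1
  ad : ∀ k, U k = 0 ∨ ∃ j ∈ R k, U k ≤ G.w k j ∧ (k ∉ E → U k = G.w k j) ∧
    ∀ q : N × S, q.2 ∈ R q.1 → U q.1 < G.w q.1 q.2 →
      bpbKey G rank b R q ≤ bpbKey G rank b R (k, j)

/-- The loop invariant of the bang-per-buck algorithm as long as every allocated ad is whole. -/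
structure IsWhole (G : Setting N S) (rank : N × S → ℕ) (b : N → ℝ) (R : N → Finset S)
    (s : BState N S) : Prop where
  avail : ∀ q, q ∈ s.avail ↔ q.2 ∈ R q.1 ∧ space G s.alloc q.1 < G.w q.1 q.2
  rem : s.rem = G.W - ∑ k, space G s.alloc k
  rem_nonneg : 0 ≤ s.rem
  ad : ∀ k, space G s.alloc k = 0 ∨ ∃ j ∈ R k, space G s.alloc k = G.w k j ∧
    ∀ q ∈ s.avail, bpbKey G rank b R q ≤ bpbKey G rank b R (k, j)

theorem space_update (G : Setting N S) (x : Allocation N S) (i : N) (j : S) (c : ℝ) :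
    space G (Function.update x i (Pi.single j c)) =
      Function.update (space G x) i (G.w i j * c) := by
  funext k
  by_cases hk : k = i
  · subst hk
    simp [space, Pi.single_apply]
  · simp [space, hk]

theorem sum_update_eq (U : N → ℝ) (i : N) (c : ℝ) :
    ∑ k, Function.update U i c k = ∑ k, U k - U i + c := by
  rw [Finset.sum_update_of_mem (Finset.mem_univ i), ← Finset.add_sum_erase _ _ (Finset.mem_univ i),
    Finset.sdiff_singleton_eq_erase]
  ring

theorem IsWhole.space_nonneg {G : Setting N S} {rank : N × S → ℕ} {b : N → ℝ}
    {R : N → Finset S} {s : BState N S} (h : IsWhole G rank b R s) (k : N) :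
    0 ≤ space G s.alloc k := by
  rcases h.ad k with h | ⟨j, -, h, -⟩
  · exact h.ge
  · rw [h]
    exact (G.w_pos k j).le

theorem isWhole_initB (G : Setting N S) (rank : N × S → ℕ) (b : N → ℝ) (R : N → Finset S) :
    IsWhole G rank b R (initB G R) where
  avail := by
    intro q
    simp [initB, space, G.w_pos]
  rem := by simp [initB, space]
  rem_nonneg := G.W_nonneg
  ad := fun k => Or.inl (by simp [initB, space])

/-- If the loop stops while all allocated ads are whole, then no advertiser is exceptional. -/
theorem IsWhole.isGreedySpace {G : Setting N S} {rank : N × S → ℕ} {b : N → ℝ}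
    {R : N → Finset S} {s : BState N S} (h : IsWhole G rank b R s)
    (hs : s.rem = 0 ∨ s.avail = ∅) :
    IsGreedySpace G rank b R (space G s.alloc) ∅ where
  nonneg := h.space_nonneg
  sum_le := by linarith [h.rem, h.rem_nonneg]
  full := by
    rcases hs with hs | hs
    · left
      linarith [h.rem]
    · right
      intro q hq
      by_contra hlt
      have := (h.avail q).2 ⟨hq, not_le.1 hlt⟩
      simp [hs] at this
  card_le := by simp
  ad := by
    intro k
    rcases h.ad k with h0 | ⟨j, hj, hw, hK⟩
    · exact Or.inl h0
    · exact Or.inr ⟨j, hj, hw.le, fun _ => hw, fun q hq hlt => hK q ((h.avail q).2 ⟨hq, hlt⟩)⟩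

/-- One round with a best available pair either keeps all ads whole or fills the whole space and
reaches a greedy space allotment. -/
theorem IsWhole.roundB {G : Setting N S} {rank : N × S → ℕ} {b : N → ℝ}
    {R : N → Finset S} {s : BState N S} (h : IsWhole G rank b R s) {p : N × S}
    (hp : p ∈ s.avail) (hbest : ∀ q ∈ s.avail, bpbKey G rank b R q ≤ bpbKey G rank b R p) :
    IsWhole G rank b R (roundB G s p) ∨ ((roundB G s p).rem = 0 ∧
      IsGreedySpace G rank b R (space G (roundB G s p).alloc) {p.1}) := by
  obtain ⟨i, j⟩ := p
  obtain ⟨hjR, hlt⟩ := (h.avail _).1 hp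
  dsimp only at hjR hlt
  by_cases hfit : G.w i j - space G s.alloc i ≤ s.rem
  · left
    have hsp : space G (RichAds.roundB G s (i, j)).alloc =
        Function.update (space G s.alloc) i (G.w i j) := by
      simp only [RichAds.roundB, if_pos hfit]
      rw [space_update, mul_one]
    have hsub : ∀ q ∈ (RichAds.roundB G s (i, j)).avail, q ∈ s.avail := by
      intro q hq
      exact (Finset.mem_filter.1 hq).1
    refine ⟨?_, ?_, ?_, ?_⟩
    · rintro ⟨k, l⟩
      rw [hsp]
      simp only [RichAds.roundB, Finset.mem_filter, h.avail]
      by_cases hk : k = i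
      · subst hk
        simp only [Function.update_self, true_and, not_le]
        exact ⟨fun hh => ⟨hh.1.1, hh.2⟩, fun hh => ⟨⟨hh.1, hlt.trans hh.2⟩, hh.2⟩⟩
      · simp [hk]
    · rw [hsp, sum_update_eq]
      simp only [RichAds.roundB, if_pos hfit]
      rw [h.rem]
      ring
    · simp only [RichAds.roundB, if_pos hfit]
      linarith
    · intro k
      rw [hsp]
      by_cases hk : k = i
      · subst hk
        exact Or.inr ⟨j, hjR, by simp, fun q hq => hbest q (hsub q hq)⟩
      · rw [Function.update_of_ne hk]
        rcases h.ad k with h0 | ⟨l, hl, hw, hK⟩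
        · exact Or.inl h0
        · exact Or.inr ⟨l, hl, hw, fun q hq => hK q (hsub q hq)⟩
  · right
    have hrem := h.rem_nonneg
    have hsp : space G (RichAds.roundB G s (i, j)).alloc =
        Function.update (space G s.alloc) i (space G s.alloc i + s.rem) := by
      simp only [RichAds.roundB, if_neg hfit]
      rw [space_update, mul_div_cancel₀ _ (G.w_pos i j).ne']
    have hsum : ∑ k, space G (RichAds.roundB G s (i, j)).alloc k = G.W := by
      rw [hsp, sum_update_eq, h.rem]
      ring
    have hmono : ∀ k, space G s.alloc k ≤ space G (RichAds.roundB G s (i, j)).alloc k := by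
      intro k
      rw [hsp]
      by_cases hk : k = i
      · subst hk
        simpa using hrem
      · rw [Function.update_of_ne hk]
    have hav : ∀ q : N × S, q.2 ∈ R q.1 →
        space G (RichAds.roundB G s (i, j)).alloc q.1 < G.w q.1 q.2 → q ∈ s.avail :=
      fun q hq hlt => (h.avail q).2 ⟨hq, (hmono q.1).trans_lt hlt⟩
    refine ⟨by simp only [RichAds.roundB, if_neg hfit], ⟨?_, hsum.le, Or.inl hsum, by simp, ?_⟩⟩
    · exact fun k => (h.space_nonneg k).trans (hmono k)
    · intro k
      by_cases hk : k = i
      · subst hk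
        refine Or.inr ⟨j, hjR, ?_, by simp, fun q hq hlt => hbest q (hav q hq hlt)⟩
        rw [hsp, Function.update_self]
        linarith
      · have hk' : space G (RichAds.roundB G s (i, j)).alloc k = space G s.alloc k := by
          rw [hsp, Function.update_of_ne hk]
        rw [hk']
        rcases h.ad k with h0 | ⟨l, hl, hw, hK⟩
        · exact Or.inl h0
        · exact Or.inr ⟨l, hl, hw.le, fun _ => hw, fun q hq hlt => hK q (hav q hq hlt)⟩

theorem exists_isGreedySpace (G : Setting N S) (rank : N × S → ℕ) (b : N → ℝ)
    (R : N → Finset S) :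
    ∃ E, IsGreedySpace G rank b R (space G (algB G rank b R)) E := by
  have key : ∀ n : ℕ, IsWhole G rank b R ((stepB G rank b R)^[n] (initB G R)) ∨
      (((stepB G rank b R)^[n] (initB G R)).rem = 0 ∧
        ∃ E, IsGreedySpace G rank b R
          (space G ((stepB G rank b R)^[n] (initB G R)).alloc) E) := by
    intro n
    induction n with
    | zero => exact Or.inl (isWhole_initB G rank b R)
    | succ n ih =>
      rw [Function.iterate_succ_apply']
      generalize (stepB G rank b R)^[n] (initB G R) = s at ih ⊢
      rcases ih with ih | ih
      · unfold stepB
        split_ifs with hs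
        · rcases ih.roundB (argBest_mem (bpbKey G rank b R) s.avail hs.2)
            (fun q hq => le_argBest (bpbKey G rank b R) s.avail hs.2 hq) with h | h
          · exact Or.inl h
          · exact Or.inr ⟨h.1, _, h.2⟩
        · exact Or.inl ih
      · rw [stepB_halted G rank b R s (Or.inl ih.1)]
        exact Or.inr ih
  rcases key (Fintype.card (N × S)) with h | h
  · exact ⟨∅, h.isGreedySpace (finalB_halted G rank b R)⟩
  · exact h.2

/-! ### Monotonicity of the allotted space -/

/-- The space that advertiser `k` wants for her reported ads that come before the key `κ` in the
order by bang-per-buck: the size of the largest of them, and `0` if there is none. -/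
noncomputable def demand (G : Setting N S) (rank : N × S → ℕ) (b : N → ℝ) (R : N → Finset S) (k : N)
    (κ : ℝ ×ₗ ℕᵒᵈ) : ℝ :=
  ((R k).filter (fun j => κ < bpbKey G rank b R (k, j))).fold max 0 (G.w k)

theorem demand_le {G : Setting N S} {rank : N × S → ℕ} {b : N → ℝ} {R : N → Finset S} {k : N}
    {κ : ℝ ×ₗ ℕᵒᵈ} {c : ℝ} (hc : 0 ≤ c)
    (h : ∀ j ∈ R k, κ < bpbKey G rank b R (k, j) → G.w k j ≤ c) :
    demand G rank b R k κ ≤ c := by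
  refine Finset.fold_max_le c |>.2 ⟨hc, fun j hj => ?_⟩
  rw [Finset.mem_filter] at hj
  exact h j hj.1 hj.2

theorem le_demand {G : Setting N S} {rank : N × S → ℕ} {b : N → ℝ} {R : N → Finset S} {k : N}
    {κ : ℝ ×ₗ ℕᵒᵈ} {j : S} (hj : j ∈ R k) (hκ : κ < bpbKey G rank b R (k, j)) :
    G.w k j ≤ demand G rank b R k κ :=
  Finset.le_fold_max _ |>.2 (Or.inr ⟨j, Finset.mem_filter.2 ⟨hj, hκ⟩, le_rfl⟩)

theorem demand_nonneg (G : Setting N S) (rank : N × S → ℕ) (b : N → ℝ) (R : N → Finset S) (k : N)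
    (κ : ℝ ×ₗ ℕᵒᵈ) : 0 ≤ demand G rank b R k κ :=
  Finset.le_fold_max _ |>.2 (Or.inl le_rfl)

/-- An advertiser gets the size of each of her ads `j`, or at least all the space that the demands
preceding `j` of the others leave. -/
theorem IsGreedySpace.lower {G : Setting N S} {rank : N × S → ℕ} (hr : Function.Injective rank)
    {b : N → ℝ} {R : N → Finset S} {U : N → ℝ} {E : Finset N} (h : IsGreedySpace G rank b R U E)
    {i : N} {j : S} (hj : j ∈ R i) :
    G.w i j ≤ U i ∨
      G.W ≤ U i + ∑ k ∈ Finset.univ.erase i, demand G rank b R k (bpbKey G rank b R (i, j)) := by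
  by_contra! hcon
  obtain ⟨hlt, hW⟩ := hcon
  rcases h.full with hfull | hfull
  · rw [← hfull, ← Finset.add_sum_erase _ _ (Finset.mem_univ i)] at hW
    refine hW.not_ge (add_le_add le_rfl (Finset.sum_le_sum fun k hk => ?_))
    rcases h.ad k with h0 | ⟨l, hl, hle, -, hK⟩
    · rw [h0]
      exact demand_nonneg ..
    · refine hle.trans (le_demand hl (lt_of_le_of_ne (hK (i, j) hj hlt) fun heq => ?_))
      exact Finset.ne_of_mem_erase hk (congrArg Prod.fst (bpbKey_injective G hr b R heq)).symm
  · exact (hfull (i, j) hj).not_gt hlt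

/-- The space of an advertiser is at most the size of one of her ads `j`, and at most the space that
the demands preceding `j` of the others leave. -/
theorem IsGreedySpace.upper {G : Setting N S} {rank : N × S → ℕ}
    {b : N → ℝ} {R : N → Finset S} {U : N → ℝ} {E : Finset N} (h : IsGreedySpace G rank b R U E)
    (i : N) :
    U i = 0 ∨ ∃ j ∈ R i, U i ≤ G.w i j ∧
      U i + ∑ k ∈ Finset.univ.erase i, demand G rank b R k (bpbKey G rank b R (i, j)) ≤ G.W := by
  rcases h.ad i with h0 | ⟨j, hj, hle, -, hK⟩
  · exact Or.inl h0
  · refine Or.inr ⟨j, hj, hle, le_trans ?_ h.sum_le⟩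
    rw [← Finset.add_sum_erase _ _ (Finset.mem_univ i)]
    refine add_le_add le_rfl (Finset.sum_le_sum fun k _ => demand_le (h.nonneg k) ?_)
    intro l hl hlt
    by_contra hw
    exact (hK (k, l) hl (not_le.1 hw)).not_gt hlt

/-- The reports `(b', R')` arise from `(b, R)` when advertiser `i` raises her bid and reports more
ads. -/
structure Improves (b : N → ℝ) (R : N → Finset S) (b' : N → ℝ) (R' : N → Finset S) (i : N) :
    Prop where
  bid_nonneg : 0 ≤ b i
  bid_le : b i ≤ b' i
  subset : R i ⊆ R' i
  bid_eq : ∀ k, k ≠ i → b' k = b k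
  set_eq : ∀ k, k ≠ i → R' k = R k

theorem Improves.value_eq (G : Setting N S) {b b' : N → ℝ} {R R' : N → Finset S} {i : N}
    (h : Improves b R b' R' i) {k : N} (hk : k ≠ i) (j : S) :
    value G b' R' k j = value G b R k j := by
  simp [value, h.bid_eq k hk, h.set_eq k hk]

theorem Improves.value_le (G : Setting N S) {b b' : N → ℝ} {R R' : N → Finset S} {i : N}
    (h : Improves b R b' R' i) {j : S} (hj : j ∈ R i) :
    value G b R i j ≤ value G b' R' i j := by
  simp only [value, hj, h.subset hj, if_true]
  exact mul_le_mul_of_nonneg_right h.bid_le (G.α_nonneg i j)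

/-- Improving the report of an advertiser moves her ads forward in the order by bang-per-buck, so
each of them leaves her at least as much space. -/
theorem IsGreedySpace.le_of_improves {G : Setting N S} {rank : N × S → ℕ}
    (hr : Function.Injective rank) {b b' : N → ℝ} {R R' : N → Finset S} {i : N}
    (h : Improves b R b' R' i) {U U' : N → ℝ} {E E' : Finset N}
    (hU : IsGreedySpace G rank b R U E) (hU' : IsGreedySpace G rank b' R' U' E') :
    U i ≤ U' i := by
  rcases hU.upper i with h0 | ⟨j, hj, hle, hsum⟩
  · rw [h0]
    exact hU'.nonneg i
  · rcases hU'.lower hr (h.subset hj) with hw | hw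
    · exact hle.trans hw
    · have hkey : bpbKey G rank b R (i, j) ≤ bpbKey G rank b' R' (i, j) := by
        apply Prod.Lex.toLex_mono
        exact ⟨div_le_div_of_nonneg_right (h.value_le G hj) (G.w_pos i j).le, le_rfl⟩
      have hdem : ∑ k ∈ Finset.univ.erase i, demand G rank b' R' k (bpbKey G rank b' R' (i, j)) ≤
          ∑ k ∈ Finset.univ.erase i, demand G rank b R k (bpbKey G rank b R (i, j)) := by
        refine Finset.sum_le_sum fun k hk => demand_le (demand_nonneg ..) fun l hl hlt => ?_
        have hki := Finset.ne_of_mem_erase hk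
        rw [h.set_eq k hki] at hl
        refine le_demand hl (hkey.trans_lt (hlt.trans_eq ?_))
        simp only [bpbKey, h.value_eq G hki]
      linarith

/-! ### Monotonicity of the rules -/

theorem clicks_algI_le {G : Setting N S} {rank : N × S → ℕ}
    (hr : Function.Injective rank) {b b' : N → ℝ} {R R' : N → Finset S} {i : N}
    (h : Improves b R b' R' i) :
    clicks G R (algI G rank b R) i ≤ clicks G R' (algI G rank b' R') i := by
  obtain ⟨E, hE⟩ := exists_isGreedySpace G rank b R
  obtain ⟨E', hE'⟩ := exists_isGreedySpace G rank b' R'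
  refine bestRow_clicks_mono G rank (h.bid_nonneg.trans h.bid_le) (Finset.filter_subset _ _)
    (Finset.filter_subset _ _) fun j hj => ?_
  rw [Finset.mem_filter] at hj ⊢
  exact ⟨h.subset hj.1, hj.2.trans (hE.le_of_improves hr h hE')⟩

theorem clicks_algMax_le {G : Setting N S} {rank : N × S → ℕ}
    (hr : Function.Injective rank) {b b' : N → ℝ} {R R' : N → Finset S} {i : N}
    (h : Improves b R b' R' i) :
    clicks G R (algMax G rank b R) i ≤ clicks G R' (algMax G rank b' R') i := by
  have hnonneg : 0 ≤ clicks G R' (algMax G rank b' R') i := by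
    unfold clicks algMax
    split_ifs
    · exact bestRow_sum_nonneg G rank b' R' i _ _ (G.α_nonneg i)
    · simp
    · simp
  by_cases hne : (Finset.univ.filter (fun p : N × S => p.2 ∈ R p.1)).Nonempty
  swap
  · have h0 : clicks G R (algMax G rank b R) i = 0 := by
      simp only [clicks, algMax, dif_neg hne]
      simp
    rwa [h0]
  by_cases hi : i = (argBest (valueKey G rank b R) _ hne).1
  swap
  · have h0 : clicks G R (algMax G rank b R) i = 0 := by
      simp only [clicks, algMax, dif_pos hne, if_neg hi]
      simp
    rwa [h0]
  have hpm := argBest_mem (valueKey G rank b R) _ hne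
  have hpb := fun q => le_argBest (valueKey G rank b R) _ hne (a := q)
  have hi2 := hi
  generalize argBest (valueKey G rank b R) _ hne = p at hi2 hpm hpb
  obtain ⟨i', j⟩ := p
  dsimp only at hi2
  subst hi2
  have hj : j ∈ R i := (Finset.mem_filter.1 hpm).2
  have hmem : (i, j) ∈ Finset.univ.filter (fun p : N × S => p.2 ∈ R' p.1) := by
    simpa using h.subset hj
  have hne' : (Finset.univ.filter (fun p : N × S => p.2 ∈ R' p.1)).Nonempty := ⟨_, hmem⟩
  have hwin : i = (argBest (valueKey G rank b' R') _ hne').1 := by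
    have hqm := argBest_mem (valueKey G rank b' R') _ hne'
    have hqb := le_argBest (valueKey G rank b' R') _ hne' hmem
    generalize argBest (valueKey G rank b' R') _ hne' = q at hqm hqb
    obtain ⟨k, l⟩ := q
    by_contra hk
    have hki : k ≠ i := fun e => hk e.symm
    have hl : l ∈ R k := by
      have := (Finset.mem_filter.1 hqm).2
      rwa [h.set_eq k hki] at this
    -- The pair `(k, l)` of another advertiser would beat `(i, j)` before the improvement, too.
    have h1 : valueKey G rank b R (i, j) ≤ valueKey G rank b' R' (i, j) :=
      Prod.Lex.toLex_mono ⟨h.value_le G hj, le_rfl⟩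
    have h2 : valueKey G rank b' R' (k, l) = valueKey G rank b R (k, l) := by
      simp only [valueKey, h.value_eq G hki]
    have h3 := hpb (k, l) (by simpa using hl)
    have h4 := le_antisymm (h1.trans (hqb.trans_eq h2)) h3
    have h5 := congrArg (fun z => OrderDual.ofDual (ofLex z).2) h4
    exact hk (congrArg Prod.fst (hr h5))
  simp only [clicks, algMax, dif_pos hne, dif_pos hne', if_pos hi, if_pos hwin]
  exact bestRow_clicks_mono G rank (h.bid_nonneg.trans h.bid_le) subset_rfl subset_rfl h.subset

theorem clicks_mixedRule_le {G : Setting N S} {rank : N × S → ℕ}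
    (hr : Function.Injective rank) {b b' : N → ℝ} {R R' : N → Finset S} {i : N}
    (h : Improves b R b' R' i) :
    clicks G R (mixedRule G rank b R) i ≤ clicks G R' (mixedRule G rank b' R') i := by
  have hmix : ∀ b R, clicks G R (mixedRule G rank b R) i =
      2 / 3 * clicks G R (algI G rank b R) i + 1 / 3 * clicks G R (algMax G rank b R) i := by
    intro b R
    simp only [clicks, mixedRule, Finset.mul_sum, ← Finset.sum_add_distrib]
    exact Finset.sum_congr rfl fun j _ => by ring
  rw [hmix, hmix]
  linarith [clicks_algI_le (G := G) hr h, clicks_algMax_le (G := G) hr h]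

theorem isMonotoneRule_mixedRule (G : Setting N S) {rank : N × S → ℕ}
    (hr : Function.Injective rank) : IsMonotoneRule G (mixedRule G rank) := by
  refine ⟨fun b R i b' hb hle => clicks_mixedRule_le hr ⟨hb i, ?_, subset_rfl, ?_, ?_⟩,
    fun b R i R' hb hle => clicks_mixedRule_le hr ⟨hb i, le_rfl, ?_, ?_, ?_⟩⟩
  · simpa using hle
  · exact fun k hk => Function.update_of_ne hk _ _
  · exact fun _ _ => rfl
  · simpa using hle
  · exact fun _ _ => rfl
  · exact fun k hk => Function.update_of_ne hk _ _

/-! ### Feasibility -/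

theorem isFeasible_of_bestRow (G : Setting N S) (rank : N × S → ℕ) (b : N → ℝ)
    (R : N → Finset S) {F : N → Finset S} {U : N → ℝ} (hF : ∀ i, F i ⊆ R i) (hU : ∀ i, 0 ≤ U i)
    (hw : ∀ i, ∀ j ∈ F i, G.w i j ≤ U i) (hsum : ∑ i, U i ≤ G.W) :
    IsFeasible G R (fun i => bestRow G rank b R i (F i)) where
  nonneg i j := by
    rcases bestRow_eq_zero_or_one G rank b R i (F i) j with h | h <;> simp [h]
  le_one i j := by
    rcases bestRow_eq_zero_or_one G rank b R i (F i) j with h | h <;> simp [h]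
  valid i j hj := bestRow_eq_zero_of_notMem G rank b R i fun h => hj (hF i h)
  unit_demand i := by
    simpa using bestRow_sum_le G rank b R i (F := F i) (f := fun _ => 1) zero_le_one
      fun _ _ => le_rfl
  total_space := by
    refine (Finset.sum_le_sum fun i _ => ?_).trans hsum
    simpa [space, mul_comm] using bestRow_sum_le G rank b R i (hU i) (hw i)

theorem isFeasible_algI (G : Setting N S) (rank : N × S → ℕ) (b : N → ℝ) (R : N → Finset S) :
    IsFeasible G R (algI G rank b R) := by
  obtain ⟨E, hE⟩ := exists_isGreedySpace G rank b R
  exact isFeasible_of_bestRow G rank b R (fun i => Finset.filter_subset _ _) hE.nonneg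
    (fun i j hj => (Finset.mem_filter.1 hj).2) hE.sum_le

/-- The rule for the maximum-value ad selects a best ad for one winner, whose reported ads include
one of maximum value, and nothing for the others. -/
theorem algMax_eq (G : Setting N S) (rank : N × S → ℕ) (b : N → ℝ) (R : N → Finset S) :
    ((∀ i, R i = ∅) ∧ algMax G rank b R = 0) ∨
    ∃ i, ∃ j ∈ R i, (∀ k, ∀ l ∈ R k, value G b R k l ≤ value G b R i j) ∧
      algMax G rank b R = fun k => bestRow G rank b R k (if k = i then R k else ∅) := by
  by_cases hne : (Finset.univ.filter (fun p : N × S => p.2 ∈ R p.1)).Nonempty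
  · right
    refine ⟨(argBest (valueKey G rank b R) _ hne).1, (argBest (valueKey G rank b R) _ hne).2,
      (Finset.mem_filter.1 (argBest_mem (valueKey G rank b R) _ hne)).2, fun k l hl => ?_, ?_⟩
    · exact value_le_of_valueKey_le (p := (k, l))
        (le_argBest (valueKey G rank b R) _ hne (by simpa using hl))
    · funext k
      by_cases hk : k = (argBest (valueKey G rank b R) _ hne).1
      · simp only [algMax, dif_pos hne, if_pos hk]
      · simp only [algMax, dif_pos hne, if_neg hk, bestRow_empty]
  · left
    refine ⟨fun i => ?_, ?_⟩
    · by_contra h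
      obtain ⟨j, hj⟩ := Finset.nonempty_iff_ne_empty.2 h
      exact hne ⟨(i, j), by simpa using hj⟩
    · funext i
      simp only [algMax, dif_neg hne]
      rfl

theorem isFeasible_zero (G : Setting N S) (R : N → Finset S) :
    IsFeasible G R (0 : Allocation N S) where
  nonneg _ _ := le_rfl
  le_one _ _ := zero_le_one
  valid _ _ _ := rfl
  unit_demand _ := by simp
  total_space := by simpa [space] using G.W_nonneg

theorem isFeasible_algMax (G : Setting N S) (rank : N × S → ℕ) (b : N → ℝ) (R : N → Finset S) :
    IsFeasible G R (algMax G rank b R) := by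
  rcases algMax_eq G rank b R with ⟨-, h⟩ | ⟨i, j, -, -, h⟩
  · rw [h]
    exact isFeasible_zero G R
  · rw [h]
    refine isFeasible_of_bestRow G rank b R (U := fun k => if k = i then G.W else 0) ?_ ?_ ?_ ?_
    · intro k
      split_ifs
      · exact subset_rfl
      · exact Finset.empty_subset _
    · intro k
      split_ifs
      · exact G.W_nonneg
      · exact le_rfl
    · intro k l hl
      split_ifs at hl ⊢
      · exact G.w_le k l
      · simp at hl
    · simp

theorem isIntegral_algI (G : Setting N S) (rank : N × S → ℕ) (b : N → ℝ) (R : N → Finset S) :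
    IsIntegral (algI G rank b R) :=
  fun _ _ => bestRow_eq_zero_or_one ..

theorem isIntegral_algMax (G : Setting N S) (rank : N × S → ℕ) (b : N → ℝ) (R : N → Finset S) :
    IsIntegral (algMax G rank b R) := by
  intro i j
  rcases algMax_eq G rank b R with ⟨-, h⟩ | ⟨i', j', -, -, h⟩
  · rw [h]
    exact Or.inl rfl
  · rw [h]
    exact bestRow_eq_zero_or_one ..

/-! ### Welfare -/

theorem value_le_bMax (G : Setting N S) (b : N → ℝ) (R : N → Finset S) (i : N) (j : S) :
    value G b R i j ≤ bMax G b R :=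
  le_ciSup (f := fun p : N × S => value G b R p.1 p.2) (Set.finite_range _).bddAbove (i, j)

theorem bMax_nonneg (G : Setting N S) {b : N → ℝ} (R : N → Finset S) (hb : ∀ i, 0 ≤ b i) :
    0 ≤ bMax G b R :=
  Real.iSup_nonneg fun p => value_nonneg G R (hb p.1) p.2

theorem bMax_le {G : Setting N S} {b : N → ℝ} {R : N → Finset S} {c : ℝ} (hc : 0 ≤ c)
    (h : ∀ i, ∀ j ∈ R i, value G b R i j ≤ c) : bMax G b R ≤ c := by
  refine Real.iSup_le (fun p => ?_) hc
  by_cases hp : p.2 ∈ R p.1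
  · exact h p.1 p.2 hp
  · simpa [value, hp] using hc

theorem socialWelfare_algMax (G : Setting N S) (rank : N × S → ℕ) {b : N → ℝ}
    (R : N → Finset S) (hb : ∀ i, 0 ≤ b i) :
    socialWelfare G b R (algMax G rank b R) = bMax G b R := by
  rcases algMax_eq G rank b R with ⟨hR, h⟩ | ⟨i, j, hj, hmax, h⟩
  · rw [h]
    have h1 := bMax_nonneg G R hb
    have h2 : bMax G b R ≤ 0 := bMax_le le_rfl (by simp [hR])
    simp [socialWelfare, le_antisymm h2 h1]
  · have hsw : socialWelfare G b R (algMax G rank b R) =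
        ∑ l, bestRow G rank b R i (R i) l * value G b R i l := by
      rw [h, socialWelfare, Finset.sum_eq_single i]
      · simp
      · intro k _ hk
        simp [hk, bestRow_empty]
      · simp
    rw [hsw]
    refine le_antisymm ?_ ?_
    · exact bestRow_sum_le G rank b R i (bMax_nonneg G R hb) fun l _ => value_le_bMax G b R i l
    · exact (bMax_le (value_nonneg G R (hb i) j) hmax).trans
        (value_le_bestRow_sum G rank b R i hj)

theorem socialWelfare_mixedRule (G : Setting N S) (rank : N × S → ℕ) (b : N → ℝ)
    (R : N → Finset S) :
    socialWelfare G b R (mixedRule G rank b R) =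
      2 / 3 * socialWelfare G b R (algI G rank b R) +
        1 / 3 * socialWelfare G b R (algMax G rank b R) := by
  simp only [socialWelfare, mixedRule, Finset.mul_sum, ← Finset.sum_add_distrib]
  exact Finset.sum_congr rfl fun i _ => Finset.sum_congr rfl fun j _ => by ring

/-- The optimum is attained because the feasible allocations form a compact set. -/
theorem isGreatest_optSW (G : Setting N S) (b : N → ℝ) (R : N → Finset S) :
    IsGreatest (socialWelfare G b R '' {x | IsFeasible G R x}) (optSW G b R) := by
  have hclosed : IsClosed {x : Allocation N S | IsFeasible G R x} := by
    have : {x : Allocation N S | IsFeasible G R x} =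
        {x | ∀ i j, 0 ≤ x i j} ∩ {x | ∀ i j, x i j ≤ 1} ∩ {x | ∀ i j, j ∉ R i → x i j = 0} ∩
          {x | ∀ i, ∑ j, x i j ≤ 1} ∩ {x | ∑ i, space G x i ≤ G.W} := by
      ext x
      exact ⟨fun h => ⟨⟨⟨⟨h.1, h.2⟩, h.3⟩, h.4⟩, h.5⟩, fun h => ⟨h.1.1.1.1, h.1.1.1.2, h.1.1.2,
        h.1.2, h.2⟩⟩
    rw [this]
    simp only [Set.ofPred_forall, space]
    refine (((IsClosed.inter ?_ ?_).inter ?_).inter ?_).inter ?_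
    · exact isClosed_iInter fun i => isClosed_iInter fun j =>
        isClosed_le (by fun_prop) (by fun_prop)
    · exact isClosed_iInter fun i => isClosed_iInter fun j =>
        isClosed_le (by fun_prop) (by fun_prop)
    · exact isClosed_iInter fun i => isClosed_iInter fun j => isClosed_iInter fun _ =>
        isClosed_eq (by fun_prop) (by fun_prop)
    · exact isClosed_iInter fun i => isClosed_le (by fun_prop) (by fun_prop)
    · exact isClosed_le (by fun_prop) (by fun_prop)
  have hcomp : IsCompact {x : Allocation N S | IsFeasible G R x} :=
    (isCompact_Icc (a := (0 : Allocation N S)) (b := 1)).of_isClosed_subset hclosed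
      fun x hx => ⟨hx.nonneg, hx.le_one⟩
  have hcont : Continuous (socialWelfare G b R) := by
    unfold socialWelfare
    fun_prop
  exact (hcomp.image hcont).isGreatest_sSup ⟨_, 0, isFeasible_zero G R, rfl⟩

theorem value_le_algI_sum {G : Setting N S} {rank : N × S → ℕ} {b : N → ℝ} {R : N → Finset S}
    {i : N} {j : S} (hj : j ∈ R i) (hw : G.w i j ≤ space G (algB G rank b R) i) :
    value G b R i j ≤ ∑ k, algI G rank b R i k * value G b R i k :=
  value_le_bestRow_sum G rank b R i (Finset.mem_filter.2 ⟨hj, hw⟩)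

/-- A price `β` per unit of space bounds the welfare of every feasible allocation: an ad that fits
into the space `U i` is worth at most what `algI` gives to its owner, and any other ad is worth at
most the price of its space. -/
theorem IsFeasible.socialWelfare_le {G : Setting N S} {rank : N × S → ℕ} {b : N → ℝ}
    {R : N → Finset S} (hb : ∀ i, 0 ≤ b i) {x : Allocation N S} (hx : IsFeasible G R x) {β : ℝ}
    (hβ : 0 ≤ β) (h : ∀ i, ∀ j ∈ R i, space G (algB G rank b R) i < G.w i j →
      value G b R i j ≤ β * G.w i j) :
    socialWelfare G b R x ≤ socialWelfare G b R (algI G rank b R) + β * G.W := by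
  have hv : ∀ i, 0 ≤ ∑ j, algI G rank b R i j * value G b R i j := fun i =>
    bestRow_sum_nonneg G rank b R i _ _ fun j => value_nonneg G R (hb i) j
  have hrow : ∀ i, ∑ j, x i j * value G b R i j ≤
      ∑ j, algI G rank b R i j * value G b R i j + β * space G x i := by
    intro i
    have hterm : ∀ j, x i j * value G b R i j ≤
        x i j * ∑ j, algI G rank b R i j * value G b R i j + β * (G.w i j * x i j) := by
      intro j
      have hxj := hx.nonneg i j
      by_cases hj : j ∈ R i
      swap
      · simp [hx.valid i j hj]
      have hw := (G.w_pos i j).le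
      rcases le_or_gt (G.w i j) (space G (algB G rank b R) i) with hle | hlt
      · have h1 := mul_le_mul_of_nonneg_left (value_le_algI_sum hj hle) hxj
        have h2 : 0 ≤ β * (G.w i j * x i j) := by positivity
        exact h1.trans (le_add_of_nonneg_right h2)
      · have h1 := mul_le_mul_of_nonneg_left (h i j hj hlt) hxj
        have h2 := mul_nonneg hxj (hv i)
        linarith
    refine (Finset.sum_le_sum fun j _ => hterm j).trans ?_
    rw [Finset.sum_add_distrib, ← Finset.sum_mul, ← Finset.mul_sum]
    exact add_le_add (mul_le_of_le_one_left (hv i) (hx.unit_demand i)) le_rfl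
  calc socialWelfare G b R x
      ≤ ∑ i, (∑ j, algI G rank b R i j * value G b R i j + β * space G x i) :=
        Finset.sum_le_sum fun i _ => hrow i
    _ = socialWelfare G b R (algI G rank b R) + β * ∑ i, space G x i := by
        rw [Finset.sum_add_distrib, ← Finset.mul_sum, socialWelfare]
    _ ≤ _ := add_le_add le_rfl (mul_le_mul_of_nonneg_left hx.total_space hβ)

/-- The price is the largest bang-per-buck among the ads that do not fit into the allotted space of
their owners. -/
theorem exists_price (G : Setting N S) (rank : N × S → ℕ) {b : N → ℝ}
    (R : N → Finset S) (hb : ∀ i, 0 ≤ b i) :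
    ∃ β : ℝ, 0 ≤ β ∧
      (∀ i, ∀ j ∈ R i, space G (algB G rank b R) i < G.w i j → value G b R i j ≤ β * G.w i j) ∧
      β * G.W ≤ socialWelfare G b R (algI G rank b R) + bMax G b R := by
  obtain ⟨E, hE⟩ := exists_isGreedySpace G rank b R
  have hv : ∀ i, 0 ≤ ∑ j, algI G rank b R i j * value G b R i j := fun i =>
    bestRow_sum_nonneg G rank b R i _ _ fun j => value_nonneg G R (hb i) j
  have hM := bMax_nonneg G R hb
  set B := Finset.univ.filter
    (fun q : N × S => q.2 ∈ R q.1 ∧ space G (algB G rank b R) q.1 < G.w q.1 q.2) with hB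
  rcases B.eq_empty_or_nonempty with hemp | hne
  · refine ⟨0, le_rfl, fun i j hj hlt => ?_, ?_⟩
    · have : (i, j) ∈ B := by simp [hB, hj, hlt]
      simp [hemp] at this
    · rw [zero_mul]
      exact add_nonneg (Finset.sum_nonneg fun i _ => hv i) hM
  obtain ⟨q, hqB, hq⟩ := B.exists_max_image
    (fun q => value G b R q.1 q.2 / G.w q.1 q.2) hne
  have hqB' := (Finset.mem_filter.1 hqB).2
  have hβ : 0 ≤ value G b R q.1 q.2 / G.w q.1 q.2 :=
    div_nonneg (value_nonneg G R (hb _) _) (G.w_pos _ _).le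
  refine ⟨value G b R q.1 q.2 / G.w q.1 q.2, hβ, fun i j hj hlt => ?_, ?_⟩
  · rw [← div_le_iff₀ (G.w_pos i j)]
    exact hq (i, j) (by simp [hB, hj, hlt])
  · generalize hβe : value G b R q.1 q.2 / G.w q.1 q.2 = β at hβ
    have hfull : ∑ k, space G (algB G rank b R) k = G.W := by
      rcases hE.full with h | h
      · exact h
      · exact absurd hqB'.2 (h q hqB'.1).not_gt
    rw [← hfull, Finset.mul_sum]
    -- The price of her space is at most the value of the greedy ad of advertiser `k`, which
    -- `algI` matches unless that ad is fractional.
    have hk : ∀ k, β * space G (algB G rank b R) k ≤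
        ∑ j, algI G rank b R k j * value G b R k j + if k ∈ E then bMax G b R else 0 := by
      intro k
      have hite : 0 ≤ if k ∈ E then bMax G b R else 0 := by
        split_ifs
        · exact hM
        · exact le_rfl
      rcases hE.ad k with h0 | ⟨j, hj, hle, heq, hK⟩
      · rw [h0, mul_zero]
        exact add_nonneg (hv k) hite
      · have h1 : β ≤ value G b R k j / G.w k j :=
          hβe ▸ ratio_le_of_bpbKey_le (hK q hqB'.1 hqB'.2)
        rw [le_div_iff₀ (G.w_pos k j)] at h1
        have h2 := (mul_le_mul_of_nonneg_left hle hβ).trans h1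
        by_cases hkE : k ∈ E
        · rw [if_pos hkE]
          linarith [hv k, value_le_bMax G b R k j]
        · linarith [value_le_algI_sum hj (heq hkE).ge]
    refine (Finset.sum_le_sum fun k _ => hk k).trans ?_
    rw [Finset.sum_add_distrib, Finset.sum_ite_mem, Finset.univ_inter, Finset.sum_const,
      nsmul_eq_mul]
    refine add_le_add le_rfl (mul_le_of_le_one_left hM ?_)
    exact_mod_cast hE.card_le

theorem optSW_le (G : Setting N S) (rank : N × S → ℕ) {b : N → ℝ}
    (R : N → Finset S) (hb : ∀ i, 0 ≤ b i) :
    optSW G b R ≤ 2 * socialWelfare G b R (algI G rank b R) + bMax G b R := by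
  obtain ⟨x, hx, hxo⟩ := (isGreatest_optSW G b R).1
  obtain ⟨β, hβ, h1, h2⟩ := exists_price G rank R hb
  have := IsFeasible.socialWelfare_le hb hx hβ h1
  rw [← hxo]
  linarith

end

/-! ### Tightness of the factor -/

/-- Total space `2 - ε`; advertiser `0` has an ad of size `ε` and an ad of size `1`, both worth `1`,
and each of the advertisers `1` and `2` has one ad of size `1` worth `1 - ε`. -/
noncomputable def tightSetting (ε : ℝ) (h0 : 0 < ε) (h1 : ε ≤ 1) : Setting (Fin 3) (Fin 4) where
  W := 2 - ε
  w _ j := if j = 0 then ε else 1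
  α _ j := if j = 0 ∨ j = 1 then 1 else 1 - ε
  W_nonneg := by linarith
  w_pos _ j := by split_ifs <;> linarith
  w_le _ j := by split_ifs <;> linarith
  α_nonneg _ j := by split_ifs <;> linarith
  α_le_one _ j := by split_ifs <;> linarith

/-- The reported ad sets for `tightSetting`. -/
def tightSets : Fin 3 → Finset (Fin 4) := ![{0, 1}, {2}, {3}]

theorem tightSetting_value_le (ε : ℝ) (h0 : 0 < ε) (h1 : ε ≤ 1) (i : Fin 3) (j : Fin 4) :
    value (tightSetting ε h0 h1) (fun _ => 1) tightSets i j ≤ 1 := by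
  simp only [value, tightSetting]
  split_ifs <;> linarith

/-- The large ad of advertiser `0` has the largest bang-per-buck among the ads of size `1`, which
leaves too little space for a whole ad of another advertiser. -/
theorem tightSetting_space_lt (ε : ℝ) (h0 : 0 < ε) (h1 : ε ≤ 1) (rank : Fin 3 × Fin 4 → ℕ)
    (i : Fin 3) (hi : i ≠ 0) :
    space (tightSetting ε h0 h1) (algB (tightSetting ε h0 h1) rank (fun _ => 1) tightSets) i
      < 1 := by
  obtain ⟨E, hE⟩ := exists_isGreedySpace (tightSetting ε h0 h1) rank (fun _ => 1) tightSets
  generalize space (tightSetting ε h0 h1)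
    (algB (tightSetting ε h0 h1) rank (fun _ => 1) tightSets) = U at hE
  have hsum := hE.sum_le
  have n0 := hE.nonneg 0
  have n1 := hE.nonneg 1
  have n2 := hE.nonneg 2
  rw [Fin.sum_univ_three] at hsum
  change U 0 + U 1 + U 2 ≤ 2 - ε at hsum
  by_contra! hU
  rcases hE.ad i with h | ⟨j, hj, -, -, hK⟩
  · linarith
  · have h01 : 1 ≤ U 0 := by
      by_contra! hlt
      have h2 := hK (0, 1) (by simp [tightSets]) (by simpa [tightSetting] using hlt)
      have h3 := ratio_le_of_bpbKey_le h2
      fin_cases i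
      · exact hi rfl
      · obtain rfl : j = 2 := by simpa [tightSets] using hj
        simp [value, tightSets, tightSetting] at h3
        linarith
      · obtain rfl : j = 3 := by simpa [tightSets] using hj
        simp [value, tightSets, tightSetting] at h3
        linarith
    fin_cases i
    · exact hi rfl
    · change 1 ≤ U 1 at hU
      linarith
    · change 1 ≤ U 2 at hU
      linarith

theorem tightSetting_mixedRule_le (ε : ℝ) (h0 : 0 < ε) (h1 : ε ≤ 1) (rank : Fin 3 × Fin 4 → ℕ) :
    socialWelfare (tightSetting ε h0 h1) (fun _ => 1) tightSets
      (mixedRule (tightSetting ε h0 h1) rank (fun _ => 1) tightSets) ≤ 1 := by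
  rw [socialWelfare_mixedRule, socialWelfare_algMax _ _ _ fun _ => zero_le_one]
  have hM : bMax (tightSetting ε h0 h1) (fun _ => 1) tightSets ≤ 1 :=
    bMax_le zero_le_one fun i j _ => tightSetting_value_le ε h0 h1 i j
  have hI : socialWelfare (tightSetting ε h0 h1) (fun _ => 1) tightSets
      (algI (tightSetting ε h0 h1) rank (fun _ => 1) tightSets) ≤ 1 := by
    rw [socialWelfare, Finset.sum_eq_single 0]
    · exact bestRow_sum_le _ _ _ _ _ zero_le_one fun j _ => tightSetting_value_le ε h0 h1 0 j
    · intro i _ hi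
      have hlt := tightSetting_space_lt ε h0 h1 rank i hi
      refine Finset.sum_eq_zero fun j _ => ?_
      rw [algI, bestRow_eq_zero_of_notMem, zero_mul]
      rw [Finset.mem_filter, not_and, not_le]
      intro hj
      have hj0 : j ≠ 0 := by
        rintro rfl
        fin_cases i
        · exact hi rfl
        · simp [tightSets] at hj
        · simp [tightSets] at hj
      simpa [tightSetting, hj0] using hlt
    · simp
  linarith

/-- The small ad of advertiser `0` together with the ads of the other two, the last of which gets
the remaining space `1 - 2 * ε`. -/
theorem le_optSW_tightSetting (ε : ℝ) (h0 : 0 < ε) (h1 : ε ≤ 1) (h2 : 2 * ε ≤ 1) :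
    3 - 4 * ε ≤ optSW (tightSetting ε h0 h1) (fun _ => 1) tightSets := by
  have hx : IsFeasible (tightSetting ε h0 h1) tightSets
      ![![1, 0, 0, 0], ![0, 0, 1, 0], ![0, 0, 0, 1 - 2 * ε]] := by
    refine ⟨?_, ?_, ?_, ?_, ?_⟩
    · intro i j
      fin_cases i <;> fin_cases j <;> simp; linarith
    · intro i j
      fin_cases i <;> fin_cases j <;> simp; linarith
    · intro i j
      fin_cases i <;> fin_cases j <;> simp [tightSets]
    · intro i
      fin_cases i <;> simp [Fin.sum_univ_four]; linarith
    · simp [Fin.sum_univ_three, Fin.sum_univ_four, space, tightSetting]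
      linarith
  refine le_trans ?_ ((isGreatest_optSW (tightSetting ε h0 h1) (fun _ => 1) tightSets).2
    ⟨_, hx, rfl⟩)
  simp [Fin.sum_univ_three, socialWelfare, value, tightSets, tightSetting]
  nlinarith

theorem exists_tight_instance {c : ℝ} (hc : c < 3) :
    ∃ (n m : ℕ) (G : Setting (Fin n) (Fin m)) (b : Fin n → ℝ) (R : Fin n → Finset (Fin m)),
      (∀ i, 0 < b i) ∧ (∀ i k, i ≠ k → Disjoint (R i) (R k)) ∧
      ∀ rank : Fin n × Fin m → ℕ, Function.Injective rank →
        c * socialWelfare G b R (mixedRule G rank b R) < optSW G b R := by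
  obtain ⟨ε, h0, h4, hc4⟩ : ∃ ε : ℝ, 0 < ε ∧ 2 * ε ≤ 1 ∧ c < 3 - 4 * ε := by
    refine ⟨min (1 / 2) ((3 - c) / 8), lt_min (by norm_num) (by linarith), ?_, ?_⟩
    · linarith [min_le_left (1 / 2) ((3 - c) / 8)]
    · linarith [min_le_right (1 / 2) ((3 - c) / 8)]
  have h1 : ε ≤ 1 := by linarith
  refine ⟨3, 4, tightSetting ε h0 h1, fun _ => 1, tightSets, fun _ => one_pos, by decide,
    fun rank _ => ?_⟩
  have hle := tightSetting_mixedRule_le ε h0 h1 rank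
  have hopt := le_optSW_tightSetting ε h0 h1 h4
  have hb : ∀ i : Fin 3, (0 : ℝ) ≤ (fun _ => 1 : Fin 3 → ℝ) i := fun _ => zero_le_one
  have h3 := optSW_le (tightSetting ε h0 h1) rank tightSets hb
  rw [← socialWelfare_algMax (tightSetting ε h0 h1) rank tightSets hb] at h3
  have hmix := socialWelfare_mixedRule (tightSetting ε h0 h1) rank (fun _ => 1) tightSets
  -- The welfare of the rule lies between `0` and `1`; the lower bound matters for negative `c`.
  rcases le_or_gt c 0 with hneg | hpos
  · nlinarith
  · nlinarith

end RichAds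

theorem mainTheorem1 :
    (∀ (N S : Type*) [Fintype N] [Fintype S] [DecidableEq N] [DecidableEq S]
      (G : RichAds.Setting N S) (rank : N × S → ℕ), Function.Injective rank →
      RichAds.IsMonotoneRule G (RichAds.mixedRule G rank) ∧
      ∀ (b : N → ℝ) (R : N → Finset S), (∀ i, 0 ≤ b i) →
        (RichAds.IsFeasible G R (RichAds.algI G rank b R) ∧
          RichAds.IsIntegral (RichAds.algI G rank b R)) ∧
        (RichAds.IsFeasible G R (RichAds.algMax G rank b R) ∧
          RichAds.IsIntegral (RichAds.algMax G rank b R)) ∧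
        RichAds.socialWelfare G b R (RichAds.algMax G rank b R) = RichAds.bMax G b R ∧
        IsGreatest (RichAds.socialWelfare G b R '' {x | RichAds.IsFeasible G R x})
          (RichAds.optSW G b R) ∧
        RichAds.optSW G b R ≤
          2 * RichAds.socialWelfare G b R (RichAds.algI G rank b R) + RichAds.bMax G b R ∧
        RichAds.optSW G b R ≤
          3 * RichAds.socialWelfare G b R (RichAds.mixedRule G rank b R)) ∧
    (∀ c : ℝ, c < 3 → ∃ (n m : ℕ) (G : RichAds.Setting (Fin n) (Fin m))
      (b : Fin n → ℝ) (R : Fin n → Finset (Fin m)),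
      (∀ i, 0 < b i) ∧ (∀ i k, i ≠ k → Disjoint (R i) (R k)) ∧
      ∀ rank : Fin n × Fin m → ℕ, Function.Injective rank →
        c * RichAds.socialWelfare G b R (RichAds.mixedRule G rank b R) <
          RichAds.optSW G b R) := by
  exact ⟨fun N S _ _ _ _ G rank hr => ⟨RichAds.isMonotoneRule_mixedRule G hr, fun b R hb =>
    ⟨⟨RichAds.isFeasible_algI G rank b R, RichAds.isIntegral_algI G rank b R⟩,
      ⟨RichAds.isFeasible_algMax G rank b R, RichAds.isIntegral_algMax G rank b R⟩,
      RichAds.socialWelfare_algMax G rank R hb, RichAds.isGreatest_optSW G b R,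
      RichAds.optSW_le G rank R hb, by
        have h := RichAds.optSW_le G rank R hb
        rw [RichAds.socialWelfare_mixedRule, RichAds.socialWelfare_algMax G rank R hb]
        linarith⟩⟩,
    fun _ hc => RichAds.exists_tight_instance hc⟩
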